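/- Let $(T,d)$ be a compact metric space and let $\eta=(\eta(t))_{t\in T}$ be a centered real random process on a probability space $(\Omega,\mathcal F,\mathbf P)$ with $\mathbf E\,\eta(t)^2<\infty$ for every $t\in T$. Suppose that almost every sample path of $\eta$ is continuous and that $\eta$ satisfies the central limit theorem in $C(T,d)$: if $\eta_1,\eta_2,\dots$ are independent copies of $\eta$ with almost surely continuous paths and $\zeta_n(t)=n^{-1/2}\sum_{j=1}^n\eta_j(t)$, then there is a centered Gaussian process $\zeta$ with continuous sample paths and with the same covariance function as $\eta$ such that $$\lim_{n\to\infty}\mathbf E\,F(\zeta_n)=\mathbf E\,F(\zeta)$$ for every bounded continuous functional $F:C(T,d)\to\mathbb R$, where $C(T,d)$ is the space of continuous functions $T\to\mathbb R$ with the uniform norm. Then there exist a deterministic semi-distance $\rho$ on $T$ (nonnegative, symmetric, zero on the diagonal, satisfying the triangle inequality) which is continuous on $T\times T$ with respect to $d$, and a (finite, real-valued) random variable $M$, such that almost surely $$|\eta(t)-\eta(s)|\le M\cdot\rho(t,s)\qquad\text{for all } t,s\in T,$$ and $$\mathbf E|M|^p<\infty\qquad\text{for every } p\in(0,2).$$ 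-/

import Mathlib

open MeasureTheory ProbabilityTheory Filter Topology
open scoped BoundedContinuousFunction

namespace ContinuousCLT

/-- The Borel σ-algebra of the space of continuous functions with the uniform norm. -/
instance instMeasurableSpaceContinuousMap (T : Type*) [TopologicalSpace T] :
    MeasurableSpace C(T, ℝ) := borel C(T, ℝ)

instance instBorelSpaceContinuousMap (T : Type*) [TopologicalSpace T] :
    BorelSpace C(T, ℝ) := ⟨rfl⟩

/-- Almost every sample path of the process is continuous. -/
def SampleContinuous {T Ω : Type*} [TopologicalSpace T] [MeasurableSpace Ω]
    (η : T → Ω → ℝ) (P : Measure Ω) : Prop :=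
  ∀ᵐ ω ∂P, Continuous fun t => η t ω

open Classical in
/-- The sample path of `η` at `ω`, as an element of `C(T)`. (On the null set where the path of a
sample continuous process is not continuous, the value is set to be the zero function.) -/
noncomputable def samplePath {T Ω : Type*} [TopologicalSpace T]
    (η : T → Ω → ℝ) (ω : Ω) : C(T, ℝ) :=
  if h : Continuous (fun t => η t ω) then ⟨fun t => η t ω, h⟩ else 0

/-- The normalized sums `ζₙ(t) = n^{-1/2} ∑_{j < n} ηⱼ(t)`, where `ηⱼ(t)(ω) = η(t)(ωⱼ)`,
`j = 0, 1, 2, …`, are the independent copies of `η` on the product space `Ω^ℕ`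
(with the product measure `P^ℕ`). -/
noncomputable def normalizedSum {T Ω : Type*} (η : T → Ω → ℝ) (n : ℕ) :
    T → (ℕ → Ω) → ℝ :=
  fun t ω => (√(n : ℝ))⁻¹ * ∑ j ∈ Finset.range n, η t (ω j)

/-- `γ` is the law on `C(T)` of a centered Gaussian process with continuous paths that has the
same covariance function as `η`. -/
structure IsGaussianLimitLaw {T Ω : Type*} [TopologicalSpace T] [MeasurableSpace Ω]
    (γ : Measure C(T, ℝ)) (η : T → Ω → ℝ) (P : Measure Ω) : Prop where
  gaussian : IsGaussianProcess (fun (t : T) (f : C(T, ℝ)) => f t) γ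
  centered : ∀ t : T, ∫ f : C(T, ℝ), f t ∂γ = 0
  covariance_eq : ∀ t s : T,
    covariance (fun f : C(T, ℝ) => f t) (fun f : C(T, ℝ) => f s) γ = covariance (η t) (η s) P

/-- The central limit theorem in `C(T)` for the sample continuous process `η`: the normalized sums
of independent copies of `η` converge weakly in `C(T)` to a centered Gaussian process with the
covariance function of `η`, that is, `E F(ζₙ) → E F(ζ)` for all bounded continuous functionals
`F : C(T) → ℝ`. -/
def SatisfiesCLT {T Ω : Type*} [TopologicalSpace T] [CompactSpace T] [MeasurableSpace Ω]
    (η : T → Ω → ℝ) (P : Measure Ω) [IsProbabilityMeasure P] : Prop :=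
  SampleContinuous η P ∧
  ∃ γ : Measure C(T, ℝ), IsProbabilityMeasure γ ∧ IsGaussianLimitLaw γ η P ∧
    ∀ F : C(T, ℝ) →ᵇ ℝ,
      Tendsto
        (fun n : ℕ => ∫ ω : ℕ → Ω, F (samplePath (normalizedSum η n) ω)
          ∂(Measure.infinitePi fun _ : ℕ => P))
        atTop (𝓝 (∫ f : C(T, ℝ), F f ∂γ))

/-- A continuous (deterministic) semi-distance on `T`. -/
structure IsContinuousSemidistance {T : Type*} [TopologicalSpace T] (ρ : T → T → ℝ) : Prop where
  nonneg : ∀ t s, 0 ≤ ρ t s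
  self : ∀ t, ρ t t = 0
  symm : ∀ t s, ρ t s = ρ s t
  triangle : ∀ t s r, ρ t r ≤ ρ t s + ρ s r
  continuous : Continuous fun x : T × T => ρ x.1 x.2

/-- The factorization `|η(t) - η(s)| ≤ M · ρ(t, s)` for all `t, s`, with probability one. -/
def Factorization {T Ω : Type*} [MeasurableSpace Ω]
    (η : T → Ω → ℝ) (P : Measure Ω) (M : Ω → ℝ) (ρ : T → T → ℝ) : Prop :=
  ∀ᵐ ω ∂P, ∀ t s : T, |η t ω - η s ω| ≤ M ω * ρ t s

end ContinuousCLT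

namespace ContinuousCLT

/-! ### Sums of independent copies: from the sum to one summand. -/

section IIDSums

variable {Ω : Type*} [MeasurableSpace Ω] {P : Measure Ω} [IsProbabilityMeasure P]

/-! Weak convergence of the normalized sums `n^(-1/2) S_n` controls weak second moments of a single
copy `X`. If `q(S_n) > ε√n` is unlikely, a single summand can rarely exceed `3ε√n`, so `n P(q(X) >
3ε√n) ≤ 1` (`nat_mul_measureReal_seminorm_le_one`). Interpolating between integers gives `t² P(q(X)
> t) ≤ 18ε²` for large `t` (`eventually_weak_tail_of_weak_convergence`).

Take for `q` a smoothed modulus of continuity `q_c` at scale `1/c`. Each continuous function has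
`q_c → 0`, so under the limit law `q_c` is small for large `c`, and the weak second moment of
`q_c(X)` can be made as small as desired (`exists_small_weak_tail_modulusSeminorm`).

Choose deterministic scales `c_k` at which it is of order `16^(-k)`. By a union bound `M = sup_k 2^k
q_{c_k}(X)` still has a finite weak second moment (`exists_envelope_of_weak_tails`), hence finite
moments of every order in `(0,2)`. Every path then has modulus at most `M 2^(-k)` at scale `1/c_k`,
and a deterministic series `ρ` encodes these bounds (`abs_sub_le_mul_scaleSemidistance`). -/

lemma infinitePi_real_eval_preimage {B : Set Ω} (hB : MeasurableSet B) (i : ℕ) :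
    (Measure.infinitePi fun _ : ℕ => P).real {ω | ω i ∈ B} = P.real B := by
  have := (measurePreserving_eval_infinitePi (fun _ : ℕ => P) i).measure_preimage
    hB.nullMeasurableSet
  simp only [Measure.real]
  exact congrArg ENNReal.toReal this

lemma infinitePi_real_eval_preimage_inter {B : Set Ω} (hB : MeasurableSet B) {i j : ℕ}
    (hij : i ≠ j) :
    (Measure.infinitePi fun _ : ℕ => P).real ({ω | ω i ∈ B} ∩ {ω | ω j ∈ B})
      = P.real B * P.real B := by
  have hind : iIndepFun (fun (i : ℕ) (ω : ℕ → Ω) => ω i) (Measure.infinitePi fun _ : ℕ => P) :=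
    iIndepFun_infinitePi (P := fun _ : ℕ => P) (X := fun _ x => x) (fun _ => measurable_id)
  have h := (hind.indepFun hij).measure_inter_preimage_eq_mul B B hB hB
  have h1 := infinitePi_real_eval_preimage (P := P) hB i
  have h2 := infinitePi_real_eval_preimage (P := P) hB j
  calc _ = _ := congrArg ENNReal.toReal h
    _ = _ := ENNReal.toReal_mul
    _ = P.real B * P.real B := congrArg₂ (· * ·) h1 h2

variable {E : Type*} [NormedAddCommGroup E] [NormedSpace ℝ E] [MeasurableSpace E] [BorelSpace E]
  [SecondCountableTopology E]

/-- If the sum of `n` independent copies of a random vector rarely exceeds the level `l`, then each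
summand exceeds the level `3 * l` with probability at most `1 / n`. -/
theorem nat_mul_measureReal_seminorm_le_one {X : Ω → E} (hX : Measurable X) (q : Seminorm ℝ E)
    (hq : Continuous q) {l : ℝ} (n : ℕ)
    (hsum : (Measure.infinitePi fun _ : ℕ => P).real
      {ω | l < q (∑ j ∈ Finset.range n, X (ω j))} ≤ 1 / 16)
    (hone : P.real {ω | l < q (X ω)} ≤ 1 / 4) :
    n * P.real {ω | 3 * l < q (X ω)} ≤ 1 := by
  set μ := Measure.infinitePi fun _ : ℕ => P with hμ
  have hqm : Measurable q := hq.measurable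
  set B : Set Ω := {ω | 3 * l < q (X ω)} with hBdef
  have hB : MeasurableSet B := measurableSet_lt measurable_const (hqm.comp hX)
  set S : (ℕ → Ω) → E := fun ω => ∑ j ∈ Finset.range n, X (ω j) with hS
  have hXj : ∀ j : ℕ, Measurable fun ω : ℕ → Ω => X (ω j) :=
    fun j => hX.comp (measurable_pi_apply j)
  have hSm : Measurable S := Finset.measurable_sum _ fun j _ => hXj j
  set C : Set (ℕ → Ω) := {ω | l < q (S ω)} with hCdef
  have hC : MeasurableSet C := measurableSet_lt measurable_const (hqm.comp hSm)
  set G : ℕ → Set (ℕ → Ω) := fun j => {ω | q (S ω - X (ω j)) ≤ 2 * l} with hGdef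
  have hG : ∀ j, MeasurableSet (G j) := fun j =>
    measurableSet_le (hqm.comp (hSm.sub (hXj j))) measurable_const
  set b : ℕ → Set (ℕ → Ω) := fun j => {ω | ω j ∈ B} with hbdef
  have hb : ∀ j, MeasurableSet (b j) := fun j => measurable_pi_apply j hB
  set p := P.real B with hp
  have hbp : ∀ j, μ.real (b j) = p := fun j => infinitePi_real_eval_preimage hB j
  -- If the rest of the sum exceeds `2l`, then the full sum or the `j`-th summand exceeds `l`; this
  -- costs at most `1/16 + 1/4 < 1/2`.
  have hGp : ∀ j, 1 / 2 ≤ μ.real (G j) := by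
    intro j
    have h1 : μ.real (G j)ᶜ ≤ μ.real C + μ.real {ω | ω j ∈ {x | l < q (X x)}} := by
      refine (measureReal_mono ?_).trans (measureReal_union_le _ _)
      intro ω hω
      simp only [hGdef, Set.mem_compl_iff, Set.mem_ofPred_eq, not_le] at hω
      by_contra hcon
      simp only [hCdef, Set.mem_union, Set.mem_ofPred_eq, not_or, not_lt] at hcon
      have := map_sub_le_add q (S ω) (X (ω j))
      linarith
    have h2 : μ.real {ω | ω j ∈ {x | l < q (X x)}} = P.real {ω | l < q (X ω)} :=
      infinitePi_real_eval_preimage (measurableSet_lt measurable_const (hqm.comp hX)) j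
    rw [h2, measureReal_compl (hG j)] at h1
    have : μ.real Set.univ = 1 := probReal_univ
    linarith
  -- `G j` involves only the summands other than the `j`-th, so it is independent of `b j`.
  have hbG : ∀ j ∈ Finset.range n, p / 2 ≤ μ.real (b j ∩ G j) := by
    intro j hj
    have hind : iIndepFun (fun (i : ℕ) (ω : ℕ → Ω) => X (ω i)) μ :=
      iIndepFun_infinitePi (P := fun _ : ℕ => P) (X := fun _ => X) (fun _ => hX)
    have hij := hind.indepFun_finsetSum_of_notMem hXj (Finset.notMem_erase j (Finset.range n))
    have h := hij.measure_inter_preimage_eq_mul {x | q x ≤ 2 * l} {x | 3 * l < q x}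
      (measurableSet_le hqm measurable_const) (measurableSet_lt measurable_const hqm)
    have e1 : (∑ i ∈ (Finset.range n).erase j, fun ω : ℕ → Ω => X (ω i)) ⁻¹' {x | q x ≤ 2 * l}
        = G j := by
      ext ω
      simp only [hGdef, Set.mem_preimage, Set.mem_ofPred_eq, Finset.sum_apply, hS]
      rw [← Finset.sum_erase_eq_sub hj]
    have e2 : (fun ω : ℕ → Ω => X (ω j)) ⁻¹' {x | 3 * l < q x} = b j := rfl
    rw [e1, e2, Set.inter_comm] at h
    have h' : μ.real (b j ∩ G j) = μ.real (G j) * μ.real (b j) := by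
      simp only [Measure.real]; rw [h, ENNReal.toReal_mul]
    rw [h', hbp]
    nlinarith [hGp j, measureReal_nonneg (μ := P) (s := B)]
  have hsub : ∀ j, b j ∩ G j ⊆ C := by
    rintro j ω ⟨h1, h2⟩
    simp only [hbdef, hBdef, hGdef, hCdef, Set.mem_ofPred_eq] at h1 h2 ⊢
    have := map_sub_le_add q (S ω) (S ω - X (ω j))
    rw [sub_sub_cancel] at this
    linarith
  by_contra! hu
  set u : ℝ := n * p with hudef
  have hu0 : 0 < u := by linarith
  -- the second moment argument for the number of large summands
  have key : ∀ ω, ∑ j ∈ Finset.range n, (b j ∩ G j).indicator (fun _ => (1 : ℝ)) ω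
      ≤ (8 * u)⁻¹ * (∑ i ∈ Finset.range n, ∑ j ∈ Finset.range n,
          (b i ∩ b j).indicator (fun _ => (1 : ℝ)) ω)
        + 2 * u * C.indicator (fun _ => (1 : ℝ)) ω := by
    intro ω
    have e : ∑ i ∈ Finset.range n, ∑ j ∈ Finset.range n,
        (b i ∩ b j).indicator (fun _ => (1 : ℝ)) ω
        = (∑ i ∈ Finset.range n, (b i).indicator (fun _ => (1 : ℝ)) ω) ^ 2 := by
      rw [sq, Finset.sum_mul_sum]
      refine Finset.sum_congr rfl fun i _ => Finset.sum_congr rfl fun j _ => ?_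
      by_cases h1 : ω ∈ b i <;> by_cases h2 : ω ∈ b j <;> simp [h1, h2]
    rw [e]
    set N := ∑ i ∈ Finset.range n, (b i).indicator (fun _ => (1 : ℝ)) ω
    have hN0 : 0 ≤ N := Finset.sum_nonneg fun i _ =>
      Set.indicator_nonneg (fun _ _ => zero_le_one) ω
    by_cases hω : ω ∈ C
    · have h1 : ∑ j ∈ Finset.range n, (b j ∩ G j).indicator (fun _ => (1 : ℝ)) ω ≤ N :=
        Finset.sum_le_sum fun j _ => Set.indicator_le_indicator_of_subset
          Set.inter_subset_left (fun _ => zero_le_one) ω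
      refine h1.trans ?_
      rw [Set.indicator_of_mem hω]
      -- AM-GM: `N ≤ N²/(8u) + 2u`. A second moment of `N` thus replaces Cauchy–Schwarz.
      have : (8 * u)⁻¹ * N ^ 2 + 2 * u * 1 - N = (8 * u)⁻¹ * (N - 4 * u) ^ 2 := by
        field_simp; ring
      have : 0 ≤ (8 * u)⁻¹ * (N - 4 * u) ^ 2 := by positivity
      linarith
    · have h1 : ∑ j ∈ Finset.range n, (b j ∩ G j).indicator (fun _ => (1 : ℝ)) ω = 0 :=
        Finset.sum_eq_zero fun j _ => Set.indicator_of_notMem (fun h => hω (hsub j h)) _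
      rw [h1, Set.indicator_of_notMem hω]
      positivity
  have hint : ∀ A : Set (ℕ → Ω), MeasurableSet A →
      Integrable (A.indicator fun _ => (1 : ℝ)) μ := fun A hA =>
    (integrable_const _).indicator hA
  have hval : ∀ A : Set (ℕ → Ω), MeasurableSet A →
      ∫ ω, A.indicator (fun _ => (1 : ℝ)) ω ∂μ = μ.real A := fun A hA => by
    rw [integral_indicator_const _ hA]; simp
  have hI2 : Integrable (fun ω => ∑ i ∈ Finset.range n, ∑ j ∈ Finset.range n,
      (b i ∩ b j).indicator (fun _ => (1 : ℝ)) ω) μ :=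
    integrable_finsetSum _ fun i _ => integrable_finsetSum _ fun j _ =>
      hint _ ((hb i).inter (hb j))
  have hle := integral_mono (μ := μ)
    (integrable_finsetSum _ fun j _ => hint _ ((hb j).inter (hG j)))
    ((hI2.const_mul _).add ((hint C hC).const_mul _)) key
  simp only [Pi.add_apply] at hle
  rw [integral_add (hI2.const_mul _) ((hint C hC).const_mul _), integral_const_mul,
    integral_const_mul, hval C hC, integral_finsetSum _
      (fun j _ => hint _ ((hb j).inter (hG j))),
    integral_finsetSum _ (fun i _ => integrable_finsetSum _ fun j _ =>
      hint _ ((hb i).inter (hb j)))] at hle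
  have hlow : u / 2 ≤ ∑ j ∈ Finset.range n,
      ∫ ω, (b j ∩ G j).indicator (fun _ => (1 : ℝ)) ω ∂μ := by
    calc u / 2 = ∑ j ∈ Finset.range n, p / 2 := by simp [hudef]; ring
      _ ≤ _ := Finset.sum_le_sum fun j hj => by
        rw [hval _ ((hb j).inter (hG j))]; exact hbG j hj
  have hp0 : 0 ≤ p := measureReal_nonneg
  have hup : ∑ i ∈ Finset.range n, ∫ ω, ∑ j ∈ Finset.range n,
      (b i ∩ b j).indicator (fun _ => (1 : ℝ)) ω ∂μ ≤ u + u ^ 2 := by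
    have : ∀ i ∈ Finset.range n, ∫ ω, ∑ j ∈ Finset.range n,
        (b i ∩ b j).indicator (fun _ => (1 : ℝ)) ω ∂μ ≤ p + n * p ^ 2 := by
      intro i hi
      rw [integral_finsetSum _ (fun j _ => hint _ ((hb i).inter (hb j)))]
      calc _ ≤ ∑ j ∈ Finset.range n, ((if i = j then p else 0) + p ^ 2) := by
            refine Finset.sum_le_sum fun j _ => ?_
            rw [hval _ ((hb i).inter (hb j))]
            split_ifs with h
            · subst h
              rw [Set.inter_self, hbp]; nlinarith
            · rw [infinitePi_real_eval_preimage_inter hB h, zero_add, sq]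
        _ = p + n * p ^ 2 := by
            rw [Finset.sum_add_distrib, Finset.sum_ite_eq, if_pos hi]; simp
    calc _ ≤ ∑ i ∈ Finset.range n, (p + n * p ^ 2) := Finset.sum_le_sum this
      _ = u + u ^ 2 := by simp [hudef]; ring
  -- Altogether `u/2 ≤ 1/8 + u/8 + u/8`, so `u ≤ 1/2`, contradicting `u > 1`.
  have h3 : (8 * u)⁻¹ * (u + u ^ 2) = 1 / 8 + u / 8 := by field_simp
  have h4 := mul_le_mul_of_nonneg_left hup (by positivity : 0 ≤ (8 * u)⁻¹)
  have h5 : 2 * u * μ.real C ≤ 2 * u * (1 / 16) := mul_le_mul_of_nonneg_left hsum (by positivity)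
  linarith

end IIDSums

/-! ### Weak second moments: integrability and envelopes. -/

section WeakTails

variable {Ω : Type*} [MeasurableSpace Ω] {P : Measure Ω} [IsProbabilityMeasure P]

/-- Layer cake formula, split at `t = 1`: below, `t^(p-1)` is integrable because `p > 0`; above, the
integrand is at most `K t^(p-3)`, integrable because `p < 2`. -/
theorem integrable_rpow_of_weak_tail {f : Ω → ℝ} (hf : Measurable f) (h0 : ∀ ω, 0 ≤ f ω) {K : ℝ}
    (hK : ∀ t : ℝ, 0 < t → t ^ 2 * P.real {ω | t < f ω} ≤ K) {p : ℝ} (hp : 0 < p) (hp2 : p < 2) :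
    Integrable (fun ω => |f ω| ^ p) P := by
  have hm : Measurable fun ω => |f ω| ^ p := by fun_prop
  refine ⟨hm.aestronglyMeasurable, ?_⟩
  rw [hasFiniteIntegral_iff_ofReal (ae_of_all _ fun ω => by positivity)]
  simp_rw [abs_of_nonneg (h0 _)]
  rw [lintegral_rpow_eq_lintegral_meas_lt_mul P (ae_of_all _ h0) hf.aemeasurable hp]
  refine ENNReal.mul_lt_top ENNReal.ofReal_lt_top ?_
  have hsplit : Set.Ioi (0 : ℝ) ⊆ Set.Ioc 0 1 ∪ Set.Ioi 1 := by
    intro t ht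
    rcases le_or_gt t 1 with h | h
    · exact Or.inl ⟨ht, h⟩
    · exact Or.inr h
  refine (lintegral_mono_set hsplit).trans_lt ?_
  refine (lintegral_union_le _ _ _).trans_lt (ENNReal.add_lt_top.2 ⟨?_, ?_⟩)
  · have hi : IntegrableOn (fun t : ℝ => t ^ (p - 1)) (Set.Ioc 0 1) := by
      have := intervalIntegral.intervalIntegrable_rpow' (a := 0) (b := 1) (r := p - 1) (by linarith)
      rwa [intervalIntegrable_iff_integrableOn_Ioc_of_le zero_le_one] at this
    refine lt_of_le_of_lt (lintegral_mono fun t => ?_) hi.lintegral_lt_top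
    calc _ ≤ 1 * ENNReal.ofReal (t ^ (p - 1)) := by gcongr; exact prob_le_one
      _ = _ := one_mul _
  · have hi : IntegrableOn (fun t : ℝ => K * t ^ (p - 3)) (Set.Ioi 1) :=
      (integrableOn_Ioi_rpow_of_lt (by linarith) zero_lt_one).const_mul K
    refine lt_of_le_of_lt (setLIntegral_mono' measurableSet_Ioi fun t ht => ?_) hi.lintegral_lt_top
    have ht0 : (0 : ℝ) < t := zero_lt_one.trans ht
    rw [← ofReal_measureReal, ← ENNReal.ofReal_mul measureReal_nonneg]
    refine ENNReal.ofReal_le_ofReal ?_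
    have e : t ^ (p - 1) = t ^ 2 * t ^ (p - 3) := by
      rw [← Real.rpow_natCast, ← Real.rpow_add ht0]; congr 1; push_cast; ring
    have := mul_le_mul_of_nonneg_right (hK t ht0) (Real.rpow_nonneg ht0.le (p - 3))
    rw [e]; linarith

/-- Countably many variables with geometrically decaying weak second moments have a common
envelope, again with finite weak second moment. -/
theorem exists_envelope_of_weak_tails {g : ℕ → Ω → ℝ} (hg : ∀ k, Measurable (g k))
    {K : ℝ} (hK : ∀ k (t : ℝ), 0 < t → t ^ 2 * P.real {ω | t < g k ω} ≤ K * (1 / 16) ^ k) :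
    ∃ M : Ω → ℝ, Measurable M ∧ (∀ ω, 0 ≤ M ω) ∧ (∀ᵐ ω ∂P, ∀ k, 2 ^ k * g k ω ≤ M ω) ∧
      ∀ t : ℝ, 0 < t → t ^ 2 * P.real {ω | t < M ω} ≤ 2 * K := by
  have hK0 : 0 ≤ K := by
    have := hK 0 1 one_pos
    have h := measureReal_nonneg (μ := P) (s := {ω | 1 < g 0 ω})
    simp only [pow_zero, mul_one, one_pow, one_mul] at this
    linarith
  -- The supremum is taken in `ENNReal`, so that its tail bound can be proved before its finiteness,
  -- which then follows from it.
  set m : Ω → ENNReal := fun ω => ⨆ k, ENNReal.ofReal (2 ^ k * g k ω) with hm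
  have hmm : Measurable m := Measurable.iSup fun k => ((hg k).const_mul _).ennreal_ofReal
  have hU : ∀ t : ℝ, 0 < t → P {ω | ENNReal.ofReal t < m ω} ≤ ENNReal.ofReal (2 * K / t ^ 2) := by
    intro t ht
    have hsub : {ω | ENNReal.ofReal t < m ω} ⊆ ⋃ k : ℕ, {ω | t / 2 ^ k < g k ω} := by
      intro ω hω
      obtain ⟨k, hk⟩ := lt_iSup_iff.1 (show ENNReal.ofReal t < m ω from hω)
      refine Set.mem_iUnion.2 ⟨k, ?_⟩
      have := (ENNReal.ofReal_lt_ofReal_iff').1 hk |>.1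
      simp only [Set.mem_ofPred_eq]
      rw [div_lt_iff₀ (by positivity)]; linarith
    refine (measure_mono hsub).trans ((measure_iUnion_le _).trans ?_)
    -- The factor `2^k` costs `4^k` against `16^(-k)`; the remaining `4^(-k)` sums to `4/3 ≤ 2`.
    have hterm : ∀ k : ℕ, P {ω | t / 2 ^ k < g k ω}
        ≤ ENNReal.ofReal (K / t ^ 2 * (1 / 4) ^ k) := by
      intro k
      rw [← ofReal_measureReal]
      refine ENNReal.ofReal_le_ofReal ?_
      have h := hK k (t / 2 ^ k) (by positivity)
      have e : (t / 2 ^ k) ^ 2 = t ^ 2 * (1 / 4) ^ k := by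
        rw [div_pow, ← pow_mul, mul_comm k 2, pow_mul]; norm_num; field_simp
        rw [← mul_pow]; norm_num
      have e2 : ((1 : ℝ) / 16) ^ k = (1 / 4) ^ k * (1 / 4) ^ k := by
        rw [← mul_pow]; norm_num
      rw [e, e2] at h
      have h4 : (0 : ℝ) < (1 / 4) ^ k := by positivity
      have : t ^ 2 * P.real {ω | t / 2 ^ k < g k ω} ≤ K * (1 / 4) ^ k := by
        refine le_of_mul_le_mul_right ?_ h4
        linarith
      rw [div_mul_eq_mul_div, le_div_iff₀ (by positivity)]
      linarith
    refine (ENNReal.tsum_le_tsum hterm).trans ?_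
    have hs : Summable fun k : ℕ => K / t ^ 2 * (1 / 4 : ℝ) ^ k :=
      (summable_geometric_of_lt_one (by norm_num) (by norm_num)).mul_left _
    rw [← ENNReal.ofReal_tsum_of_nonneg (fun k => by positivity) hs]
    refine ENNReal.ofReal_le_ofReal ?_
    rw [tsum_mul_left, tsum_geometric_of_lt_one (by norm_num) (by norm_num), div_mul_eq_mul_div]
    refine div_le_div_of_nonneg_right ?_ (by positivity)
    norm_num; linarith
  have hfin : ∀ᵐ ω ∂P, m ω ≠ ⊤ := by
    have h0 : Tendsto (fun t : ℝ => ENNReal.ofReal (2 * K / t ^ 2)) atTop (𝓝 0) := by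
      have : Tendsto (fun t : ℝ => 2 * K / t ^ 2) atTop (𝓝 0) :=
        tendsto_const_nhds.div_atTop (tendsto_pow_atTop two_ne_zero)
      simpa using ENNReal.tendsto_ofReal this
    have hle : P {ω | m ω = ⊤} ≤ 0 := by
      refine ge_of_tendsto h0 ?_
      filter_upwards [eventually_gt_atTop 0] with t ht
      refine (measure_mono ?_).trans (hU t ht)
      intro ω hω
      simp only [Set.mem_ofPred_eq] at hω ⊢
      rw [hω]; exact ENNReal.ofReal_lt_top
    rw [ae_iff]; simpa using hle
  refine ⟨fun ω => (m ω).toReal, hmm.ennreal_toReal, fun ω => ENNReal.toReal_nonneg, ?_, ?_⟩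
  · filter_upwards [hfin] with ω hω k
    exact (ENNReal.ofReal_le_iff_le_toReal hω).1
      (le_iSup (fun k => ENNReal.ofReal (2 ^ k * g k ω)) k)
  · intro t ht
    have h1 : P {ω | t < (m ω).toReal} ≤ ENNReal.ofReal (2 * K / t ^ 2) := by
      refine (measure_mono ?_).trans (hU t ht)
      intro ω hω
      simp only [Set.mem_ofPred_eq] at hω ⊢
      exact ENNReal.ofReal_lt_iff_lt_toReal ht.le (by
        intro h; rw [h] at hω; simp at hω; linarith) |>.2 hω
    have h2 := ENNReal.toReal_le_of_le_ofReal (by positivity) h1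
    rw [le_div_iff₀ (by positivity)] at h2
    simp only [Measure.real]
    linarith

end WeakTails

/-! ### From weak convergence to tails of one copy. -/

section Tails

variable {Ω : Type*} [MeasurableSpace Ω] {P : Measure Ω} [IsProbabilityMeasure P]

lemma tendsto_measureReal_of_antitone {s : ℕ → Set Ω} (hs : ∀ n, MeasurableSet (s n))
    (ha : Antitone s) (he : ⋂ n, s n = ∅) : Tendsto (fun n => P.real (s n)) atTop (𝓝 0) := by
  have h := tendsto_measure_iInter_atTop (μ := P) (fun n => (hs n).nullMeasurableSet) ha
    ⟨0, measure_ne_top _ _⟩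
  rw [he, measure_empty] at h
  exact (ENNReal.tendsto_toReal ENNReal.zero_ne_top).comp h

variable {E : Type*} [NormedAddCommGroup E] [NormedSpace ℝ E] [MeasurableSpace E] [BorelSpace E]
  [SecondCountableTopology E]

/-- If the normalized sums of independent copies of `X` converge weakly to `γ`, and the seminorm `q`
is small in comparison to `ε` under `γ`, then the tail of `q X` is eventually at most
`18 * ε ^ 2 / t ^ 2`. -/
theorem eventually_weak_tail_of_weak_convergence {X : Ω → E} (hX : Measurable X) (γ : Measure E)
    [IsProbabilityMeasure γ]
    (hconv : ∀ F : E →ᵇ ℝ, Tendsto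
      (fun n : ℕ => ∫ ω : ℕ → Ω, F ((√(n : ℝ))⁻¹ • ∑ j ∈ Finset.range n, X (ω j))
        ∂(Measure.infinitePi fun _ : ℕ => P)) atTop (𝓝 (∫ f, F f ∂γ)))
    (q : Seminorm ℝ E) (hq : Continuous q) {ε : ℝ} (hε : 0 < ε)
    (hγ : ∫ f, min 1 (q f / ε) ∂γ < 1 / 16) :
    ∃ t₀ : ℝ, 0 < t₀ ∧ ∀ t, t₀ ≤ t → t ^ 2 * P.real {ω | t < q (X ω)} ≤ 18 * ε ^ 2 := by
  set μ := Measure.infinitePi fun _ : ℕ => P with hμ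
  have hqm : Measurable q := hq.measurable
  have hFc : Continuous fun f => min 1 (q f / ε) := by fun_prop
  have hF0 : ∀ f, 0 ≤ min 1 (q f / ε) := fun f =>
    le_min zero_le_one (div_nonneg (apply_nonneg q f) hε.le)
  let F : E →ᵇ ℝ := BoundedContinuousFunction.ofNormedAddCommGroup _ hFc 1 fun f => by
    rw [Real.norm_of_nonneg (hF0 f)]; exact min_le_left _ _
  have hFe : ∀ f, F f = min 1 (q f / ε) := fun f => rfl
  have h1 : ∀ᶠ n : ℕ in atTop, ∫ ω : ℕ → Ω, F ((√(n : ℝ))⁻¹ • ∑ j ∈ Finset.range n, X (ω j)) ∂μ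
      < 1 / 16 := (hconv F).eventually_lt_const hγ
  -- The one-summand condition is automatic for large `n`, since the level `ε√n` tends to infinity.
  have h2 : ∀ᶠ n : ℕ in atTop, P.real {ω | ε * √(n : ℝ) < q (X ω)} < 1 / 4 := by
    refine (tendsto_measureReal_of_antitone (P := P)
      (fun n => measurableSet_lt measurable_const (hqm.comp hX)) ?_ ?_).eventually_lt_const
        (by norm_num)
    · intro m n hmn ω hω
      simp only [Set.mem_ofPred_eq] at hω ⊢
      refine lt_of_le_of_lt ?_ hω
      gcongr
    · refine Set.eq_empty_of_forall_notMem fun ω hω => ?_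
      have ht : Tendsto (fun n : ℕ => ε * √(n : ℝ)) atTop atTop :=
        (Real.tendsto_sqrt_atTop.comp tendsto_natCast_atTop_atTop).const_mul_atTop hε
      obtain ⟨n, hn⟩ := (ht.eventually_ge_atTop (q (X ω))).exists
      exact absurd (Set.mem_iInter.1 hω n) (by simpa using hn)
  obtain ⟨n₀, hn₀⟩ := eventually_atTop.1 (h1.and h2)
  have h3 : ∀ n : ℕ, n₀ ≤ n → 1 ≤ n → n * P.real {ω | 3 * (ε * √(n : ℝ)) < q (X ω)} ≤ 1 := by
    intro n hn hn1
    obtain ⟨ha, hb⟩ := hn₀ n hn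
    refine nat_mul_measureReal_seminorm_le_one hX q hq n ?_ hb.le
    have hs : 0 < √(n : ℝ) := Real.sqrt_pos.2 (by exact_mod_cast hn1)
    have hSm : Measurable fun ω : ℕ → Ω => ∑ j ∈ Finset.range n, X (ω j) :=
      Finset.measurable_sum _ fun j _ => hX.comp (measurable_pi_apply j)
    have hint : Integrable (fun ω : ℕ → Ω => F ((√(n : ℝ))⁻¹ • ∑ j ∈ Finset.range n, X (ω j))) μ :=
      Integrable.of_bound (F.continuous.measurable.comp (hSm.const_smul _)).aestronglyMeasurable 1
        (ae_of_all _ fun ω => by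
          rw [hFe, Real.norm_of_nonneg (hF0 _)]; exact min_le_left _ _)
    -- Markov's inequality for the truncated functional, which equals `1` where the sum exceeds
    -- `ε√n`.
    have hm := mul_meas_ge_le_integral_of_nonneg (μ := μ) (ae_of_all _ fun ω => hF0 _) hint 1
    rw [one_mul] at hm
    refine (measureReal_mono ?_).trans (hm.trans ha.le)
    intro ω hω
    simp only [Set.mem_ofPred_eq] at hω ⊢
    refine le_min le_rfl ?_
    rw [map_smul_eq_mul, Real.norm_of_nonneg (by positivity), le_div_iff₀ hε, inv_mul_eq_div,
      le_div_iff₀ hs]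
    linarith
  refine ⟨3 * ε * (n₀ + 1), by positivity, fun t ht => ?_⟩
  have hn₀0 : (0 : ℝ) ≤ n₀ := n₀.cast_nonneg
  have hx : (n₀ : ℝ) + 1 ≤ (t / (3 * ε)) ^ 2 := by
    have : (n₀ : ℝ) + 1 ≤ t / (3 * ε) := by rw [le_div_iff₀ (by positivity)]; linarith
    nlinarith
  set x := (t / (3 * ε)) ^ 2 with hxdef
  have ht0 : 0 < t := lt_of_lt_of_le (by positivity) ht
  have hfl : n₀ + 1 ≤ ⌊x⌋₊ := Nat.le_floor (by push_cast; exact hx)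
  -- The largest `n` with `3ε√n ≤ t`. Since `n ≥ 1`, `t² = 9ε²x ≤ 9ε²(n+1) ≤ 18ε²n`, whence the
  -- constant 18.
  set n := ⌊x⌋₊
  have hnx : (n : ℝ) ≤ x := Nat.floor_le (by positivity)
  have hxn : x < n + 1 := Nat.lt_floor_add_one x
  have hn1 : (1 : ℝ) ≤ n := by exact_mod_cast (by omega : 1 ≤ n)
  have h4 := h3 n (by omega) (by omega)
  have h5 : 3 * (ε * √(n : ℝ)) ≤ t := by
    have : √(n : ℝ) ≤ t / (3 * ε) := Real.sqrt_le_iff.2 ⟨by positivity, hnx⟩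
    rw [le_div_iff₀ (by positivity)] at this
    linarith
  have h6 : P.real {ω | t < q (X ω)} ≤ P.real {ω | 3 * (ε * √(n : ℝ)) < q (X ω)} :=
    measureReal_mono fun ω hω => lt_of_le_of_lt h5 hω
  have h7 : t ^ 2 = 9 * ε ^ 2 * x := by rw [hxdef]; field_simp; norm_num
  have h8 : t ^ 2 ≤ 18 * ε ^ 2 * n := by
    rw [h7]; nlinarith [sq_nonneg ε]
  calc t ^ 2 * P.real {ω | t < q (X ω)}
      ≤ 18 * ε ^ 2 * n * P.real {ω | 3 * (ε * √(n : ℝ)) < q (X ω)} :=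
        mul_le_mul h8 h6 measureReal_nonneg (by positivity)
    _ = 18 * ε ^ 2 * (n * P.real {ω | 3 * (ε * √(n : ℝ)) < q (X ω)}) := by ring
    _ ≤ 18 * ε ^ 2 * 1 := by gcongr
    _ = _ := mul_one _

end Tails

/-! ### Smoothed moduli of continuity as continuous seminorms. -/

section Modulus

variable {T : Type*} [MetricSpace T] [CompactSpace T]

/-- The weight `max 0 (1 - c * d (t, s))`, localizing near the diagonal. -/
noncomputable def diagonalWeight (T : Type*) [MetricSpace T] (c : ℕ) : C(T × T, ℝ) where
  toFun x := max 0 (1 - c * dist x.1 x.2)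
  continuous_toFun := by fun_prop

/-- A smoothed modulus of continuity at scale `1 / c`. -/
noncomputable def modulusSeminorm (T : Type*) [MetricSpace T] [CompactSpace T] (c : ℕ) :
    Seminorm ℝ C(T, ℝ) :=
  (normSeminorm ℝ C(T × T, ℝ)).comp
    ({ toFun := fun f => diagonalWeight T c * (f.comp .fst - f.comp .snd)
       map_add' := fun f g => by ext x; simp; ring
       map_smul' := fun a f => by ext x; simp; ring } : C(T, ℝ) →ₗ[ℝ] C(T × T, ℝ))

lemma modulusSeminorm_apply (c : ℕ) (f : C(T, ℝ)) :
    modulusSeminorm T c f = ‖diagonalWeight T c * (f.comp .fst - f.comp .snd)‖ := rfl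

lemma continuous_modulusSeminorm (c : ℕ) : Continuous (modulusSeminorm T c) := by
  have h1 := ContinuousMap.continuous_precomp (Z := ℝ) (ContinuousMap.fst : C(T × T, T))
  have h2 := ContinuousMap.continuous_precomp (Z := ℝ) (ContinuousMap.snd : C(T × T, T))
  exact (continuous_const.mul (h1.sub h2)).norm

lemma weight_mul_abs_sub_le (c : ℕ) (f : C(T, ℝ)) (t s : T) :
    max 0 (1 - c * dist t s) * |f t - f s| ≤ modulusSeminorm T c f := by
  have h := ContinuousMap.norm_coe_le_norm
    (diagonalWeight T c * (f.comp .fst - f.comp .snd)) (t, s)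
  refine le_of_eq_of_le ?_ h
  simp [diagonalWeight, abs_of_nonneg (le_max_left (0 : ℝ) _)]

lemma modulusSeminorm_le_iff {c : ℕ} {f : C(T, ℝ)} {a : ℝ} (ha : 0 ≤ a) :
    modulusSeminorm T c f ≤ a ↔ ∀ t s, max 0 (1 - c * dist t s) * |f t - f s| ≤ a := by
  refine ⟨fun h t s => (weight_mul_abs_sub_le c f t s).trans h, fun h => ?_⟩
  rw [modulusSeminorm_apply, ContinuousMap.norm_le _ ha]
  rintro ⟨t, s⟩
  refine le_of_eq_of_le ?_ (h t s)
  simp [diagonalWeight, abs_of_nonneg (le_max_left (0 : ℝ) _)]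

lemma antitone_modulusSeminorm (f : C(T, ℝ)) : Antitone fun c => modulusSeminorm T c f := by
  intro c c' hcc
  refine (modulusSeminorm_le_iff (apply_nonneg _ _)).2 fun t s =>
    le_trans ?_ (weight_mul_abs_sub_le c f t s)
  gcongr

/-- By compactness `f` is uniformly continuous: pairs closer than `δ` contribute little, and the
weight kills all other pairs once `c δ > 1`. -/
lemma tendsto_modulusSeminorm (f : C(T, ℝ)) :
    Tendsto (fun c => modulusSeminorm T c f) atTop (𝓝 0) := by
  refine Metric.tendsto_atTop.2 fun ε hε => ?_
  obtain ⟨δ, hδ, hf⟩ := Metric.uniformContinuous_iff.1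
    (CompactSpace.uniformContinuous_of_continuous f.continuous) (ε / 2) (by positivity)
  obtain ⟨N, hN⟩ := exists_nat_gt (1 / δ)
  refine ⟨N, fun c hc => ?_⟩
  rw [Real.dist_0_eq_abs, abs_of_nonneg (apply_nonneg _ _)]
  refine lt_of_le_of_lt ((modulusSeminorm_le_iff (a := ε / 2) (by positivity)).2 ?_) (by linarith)
  intro t s
  have hcδ : 1 < c * δ := by
    have : (N : ℝ) ≤ c := by exact_mod_cast hc
    rw [div_lt_iff₀ hδ] at hN
    nlinarith
  rcases lt_or_ge (dist t s) δ with h | h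
  · have h1 : |f t - f s| ≤ ε / 2 := (hf h).le
    have h2 : max 0 (1 - c * dist t s) ≤ 1 := max_le zero_le_one (by
      have : 0 ≤ c * dist t s := by positivity
      linarith)
    calc _ ≤ 1 * (ε / 2) := by gcongr
      _ = _ := one_mul _
  · have : 1 - c * dist t s ≤ 0 := by
      have : c * δ ≤ c * dist t s := by gcongr
      linarith
    rw [max_eq_left this, zero_mul]; positivity

end Modulus

/-! ### Sample paths as random elements of `C(T)`. -/

section Paths

variable {T : Type*} [MetricSpace T] [CompactSpace T] {Ω : Type*} [MeasurableSpace Ω]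
  {P : Measure Ω}

/-- A continuous injection out of a Polish space is a measurable embedding (Lusin–Souslin). It
reduces Borel measurability in `C(T)` to countably many evaluations. -/
lemma measurableEmbedding_restrict_dense {D : Set T} (hDc : D.Countable) (hD : Dense D) :
    MeasurableEmbedding fun (f : C(T, ℝ)) (d : D) => f d := by
  have := hDc.to_subtype
  refine Continuous.measurableEmbedding (continuous_pi fun d => continuous_eval_const _) ?_
  intro f g h
  refine ContinuousMap.ext fun t => ?_
  refine congrFun (Continuous.ext_on hD f.continuous g.continuous fun d hd => ?_) t
  exact congrFun h ⟨d, hd⟩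

lemma samplePath_apply_of_continuous {T Ω : Type*} [TopologicalSpace T] {η : T → Ω → ℝ} {ω : Ω}
    (h : Continuous fun t => η t ω) (t : T) : samplePath η ω t = η t ω := by
  simp [samplePath, h]

/-- A sample continuous process agrees almost surely with a random element of `C(T)`. -/
theorem exists_measurable_path {η : T → Ω → ℝ} (hη : ∀ t, AEMeasurable (η t) P)
    (hc : SampleContinuous η P) :
    ∃ X : Ω → C(T, ℝ), Measurable X ∧ ∀ᵐ ω ∂P, ∀ t, X ω t = η t ω := by
  obtain ⟨D, hDc, hDd⟩ := TopologicalSpace.exists_countable_dense T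
  have := hDc.to_subtype
  have hm : AEMeasurable (samplePath η) P := by
    refine (measurableEmbedding_restrict_dense hDc hDd).aemeasurable_comp_iff.1 ?_
    refine aemeasurable_pi_iff.2 fun d => (hη d).congr ?_
    filter_upwards [hc] with ω hω
    exact (samplePath_apply_of_continuous hω _).symm
  refine ⟨hm.mk _, hm.measurable_mk, ?_⟩
  filter_upwards [hm.ae_eq_mk, hc] with ω h1 h2 t
  rw [← h1, samplePath_apply_of_continuous h2]

lemma samplePath_normalizedSum_ae_eq [IsProbabilityMeasure P] {η : T → Ω → ℝ} {X : Ω → C(T, ℝ)}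
    (hX : ∀ᵐ ω ∂P, ∀ t, X ω t = η t ω) (n : ℕ) :
    ∀ᵐ ω ∂(Measure.infinitePi fun _ : ℕ => P),
      samplePath (normalizedSum η n) ω = (√(n : ℝ))⁻¹ • ∑ j ∈ Finset.range n, X (ω j) := by
  have h : ∀ᵐ ω ∂(Measure.infinitePi fun _ : ℕ => P), ∀ (j : ℕ) (t : T), X (ω j) t = η t (ω j) :=
    ae_all_iff.2 fun j =>
      (measurePreserving_eval_infinitePi (fun _ : ℕ => P) j).quasiMeasurePreserving.ae hX
  filter_upwards [h] with ω hω
  have e : ∀ t, normalizedSum η n t ω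
      = ((√(n : ℝ))⁻¹ • ∑ j ∈ Finset.range n, X (ω j) : C(T, ℝ)) t := by
    intro t
    simp [normalizedSum, hω]
  have hcont : Continuous fun t => normalizedSum η n t ω := by
    simp_rw [e]; exact ContinuousMap.continuous _
  ext t
  rw [samplePath_apply_of_continuous hcont, e]

end Paths

/-! ### The deterministic semi-distance built from the scales. -/

section Semidistance

variable {T : Type*} [MetricSpace T]

/-- The semi-distance `∑ k, 2 * 2 ^ (-k) * min 1 (2 * c (k + 1) * d (t, s))`. -/
noncomputable def scaleSemidistance (c : ℕ → ℕ) (t s : T) : ℝ :=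
  ∑' k : ℕ, 2 * (1 / 2) ^ k * min 1 (2 * c (k + 1) * dist t s)

lemma scaleSemidistance_term_nonneg (c : ℕ → ℕ) (t s : T) (k : ℕ) :
    0 ≤ 2 * (1 / 2 : ℝ) ^ k * min 1 (2 * c (k + 1) * dist t s) := by positivity

lemma scaleSemidistance_term_le (c : ℕ → ℕ) (t s : T) (k : ℕ) :
    2 * (1 / 2 : ℝ) ^ k * min 1 (2 * c (k + 1) * dist t s) ≤ 2 * (1 / 2) ^ k :=
  mul_le_of_le_one_right (by positivity) (min_le_left _ _)

lemma summable_two_mul_geometric : Summable fun k : ℕ => 2 * (1 / 2 : ℝ) ^ k :=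
  summable_geometric_two.mul_left 2

lemma summable_scaleSemidistance (c : ℕ → ℕ) (t s : T) :
    Summable fun k : ℕ => 2 * (1 / 2 : ℝ) ^ k * min 1 (2 * c (k + 1) * dist t s) :=
  Summable.of_nonneg_of_le (scaleSemidistance_term_nonneg c t s)
    (scaleSemidistance_term_le c t s) summable_two_mul_geometric

lemma isContinuousSemidistance_scaleSemidistance (c : ℕ → ℕ) :
    IsContinuousSemidistance (scaleSemidistance (T := T) c) where
  nonneg t s := tsum_nonneg (scaleSemidistance_term_nonneg c t s)
  self t := by simp [scaleSemidistance]
  symm t s := by simp only [scaleSemidistance, dist_comm]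
  triangle t s r := by
    unfold scaleSemidistance
    rw [← (summable_scaleSemidistance c t s).tsum_add (summable_scaleSemidistance c s r)]
    refine (summable_scaleSemidistance c t r).tsum_le_tsum (fun k => ?_)
      ((summable_scaleSemidistance c t s).add (summable_scaleSemidistance c s r))
    rw [← mul_add]
    refine mul_le_mul_of_nonneg_left ?_ (by positivity)
    have h1 : 2 * c (k + 1) * dist t r ≤ 2 * c (k + 1) * dist t s + 2 * c (k + 1) * dist s r := by
      rw [← mul_add]; exact mul_le_mul_of_nonneg_left (dist_triangle _ _ _) (by positivity)
    have h2 : 0 ≤ 2 * c (k + 1) * dist t s := by positivity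
    have h3 : 0 ≤ 2 * c (k + 1) * dist s r := by positivity
    rcases min_cases 1 (2 * c (k + 1) * dist t s) with h | h <;>
    rcases min_cases 1 (2 * c (k + 1) * dist s r) with h' | h' <;>
    rcases min_cases 1 (2 * c (k + 1) * dist t r) with h'' | h'' <;> linarith
  continuous := by
    refine continuous_tsum (fun k => by fun_prop) summable_two_mul_geometric fun k x => ?_
    rw [Real.norm_of_nonneg (scaleSemidistance_term_nonneg c x.1 x.2 k)]
    exact scaleSemidistance_term_le c x.1 x.2 k

/-- Bounds on all scales combine to a bound by the semi-distance. -/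
lemma abs_sub_le_mul_scaleSemidistance [CompactSpace T] {c : ℕ → ℕ} (hc0 : c 0 = 0) (hc : ∀ k, k ≤ c k)
    {f : C(T, ℝ)} {M : ℝ} (hM0 : 0 ≤ M) (hM : ∀ k, 2 ^ k * modulusSeminorm T (c k) f ≤ M)
    (t s : T) : |f t - f s| ≤ M * scaleSemidistance c t s := by
  have hρ := (isContinuousSemidistance_scaleSemidistance (T := T) c).nonneg t s
  rcases eq_or_ne t s with rfl | hts
  · simpa using mul_nonneg hM0 hρ
  have hd : 0 < dist t s := dist_pos.2 hts
  have hex : ∃ k, 1 < 2 * c (k + 1) * dist t s := by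
    obtain ⟨k, hk⟩ := exists_nat_gt (1 / dist t s)
    refine ⟨k, ?_⟩
    rw [div_lt_iff₀ hd] at hk
    have : (k : ℝ) ≤ c (k + 1) := by exact_mod_cast (Nat.le_succ k).trans (hc (k + 1))
    nlinarith
  classical
  -- At this first `k` the `k`-th term of the series is saturated, so `ρ ≥ 2 · 2^(-k)`, while
  -- minimality gives `c_k d ≤ 1/2`, so the weight at scale `c_k` is at least `1/2`. For `k = 0` the
  -- latter comes from `c 0 = 0`.
  set k := Nat.find hex with hkdef
  have hk : 1 < 2 * c (k + 1) * dist t s := Nat.find_spec hex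
  have hk' : 2 * c k * dist t s ≤ 1 := by
    rcases Nat.eq_zero_or_pos k with h | h
    · rw [h, hc0]; simp
    · obtain ⟨m, hm⟩ : ∃ m, k = m + 1 := ⟨k - 1, by omega⟩
      rw [hm]
      exact not_lt.1 (Nat.find_min hex (show m < Nat.find hex by omega))
  have h1 : 1 / 2 * |f t - f s| ≤ modulusSeminorm T (c k) f := by
    refine le_trans ?_ (weight_mul_abs_sub_le (c k) f t s)
    refine mul_le_mul_of_nonneg_right ?_ (abs_nonneg _)
    exact le_trans (by linarith) (le_max_right _ _)
  have h2 : 2 * (1 / 2 : ℝ) ^ k ≤ scaleSemidistance c t s := by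
    have := (summable_scaleSemidistance c t s).le_tsum k
      fun j _ => scaleSemidistance_term_nonneg c t s j
    rwa [min_eq_left hk.le, mul_one] at this
  have h3 : modulusSeminorm T (c k) f ≤ M * (1 / 2) ^ k := by
    rw [one_div, inv_pow, ← div_eq_mul_inv, le_div_iff₀ (by positivity)]
    linarith [hM k]
  have h4 := mul_le_mul_of_nonneg_left h2 hM0
  linarith

end Semidistance

/-! ### Weak second moments of the path moduli. -/

section WeakModulus

variable {T : Type*} [MetricSpace T] [CompactSpace T] {Ω : Type*} [MeasurableSpace Ω]
  {P : Measure Ω} [IsProbabilityMeasure P] {X : Ω → C(T, ℝ)} {γ : Measure C(T, ℝ)}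
  [IsProbabilityMeasure γ]

lemma measurable_modulusSeminorm_comp (hX : Measurable X) (c : ℕ) :
    Measurable fun ω => modulusSeminorm T c (X ω) :=
  (continuous_modulusSeminorm c).measurable.comp hX

/-- With `c` fixed, `ε = m + 1` is taken so large that the truncated integral under `γ` is small;
tails below `t₀` are bounded trivially by `t₀²`. It supplies the bound at scale `c = 0`, where the
seminorm is the full oscillation and need not be small. -/
theorem exists_weak_tail_modulusSeminorm (hX : Measurable X)
    (hconv : ∀ F : C(T, ℝ) →ᵇ ℝ, Tendsto
      (fun n : ℕ => ∫ ω : ℕ → Ω, F ((√(n : ℝ))⁻¹ • ∑ j ∈ Finset.range n, X (ω j))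
        ∂(Measure.infinitePi fun _ : ℕ => P)) atTop (𝓝 (∫ f, F f ∂γ))) (c : ℕ) :
    ∃ K : ℝ, ∀ t : ℝ, 0 < t → t ^ 2 * P.real {ω | t < modulusSeminorm T c (X ω)} ≤ K := by
  have hlim : Tendsto (fun m : ℕ => ∫ f, min 1 (modulusSeminorm T c f / (m + 1 : ℝ)) ∂γ) atTop
      (𝓝 (∫ _, (0 : ℝ) ∂γ)) := by
    refine tendsto_integral_of_dominated_convergence (fun _ => 1) (fun m => ?_)
      (integrable_const _) (fun m => ae_of_all _ fun f => ?_) (ae_of_all _ fun f => ?_)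
    · have := continuous_modulusSeminorm (T := T) c
      exact (by fun_prop : Continuous fun f => min 1
        (modulusSeminorm T c f / (m + 1 : ℝ))).aestronglyMeasurable
    · rw [Real.norm_of_nonneg (le_min zero_le_one (div_nonneg (apply_nonneg _ _) (by positivity)))]
      exact min_le_left _ _
    · have h : Tendsto (fun m : ℕ => modulusSeminorm T c f / (m + 1 : ℝ)) atTop (𝓝 0) :=
        tendsto_const_nhds.div_atTop
          (tendsto_atTop_add_const_right _ _ tendsto_natCast_atTop_atTop)
      simpa using (tendsto_const_nhds (x := (1 : ℝ))).min h
  rw [integral_zero] at hlim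
  obtain ⟨m, hm⟩ := (hlim.eventually_lt_const (by norm_num : (0 : ℝ) < 1 / 16)).exists
  obtain ⟨t₀, ht₀, h⟩ := eventually_weak_tail_of_weak_convergence hX γ hconv
    (modulusSeminorm T c) (continuous_modulusSeminorm c) (by positivity : (0 : ℝ) < m + 1) hm
  refine ⟨max (18 * (m + 1 : ℝ) ^ 2) (t₀ ^ 2), fun t ht => ?_⟩
  rcases le_or_gt t₀ t with h' | h'
  · exact (h t h').trans (le_max_left _ _)
  · refine le_trans ?_ (le_max_right _ _)
    calc _ ≤ t₀ ^ 2 * 1 := by gcongr; exact measureReal_le_one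
      _ = _ := mul_one _

/-- Three ranges of `t`. A first scale `c₀`, small under `γ`, handles `t ≥ t₀`, and `t ≤ ε` is
trivial. With `t₀` now fixed, a finer `c ≥ c₀` makes `t₀² P(q_c(X) > ε)` small for the middle range;
monotonicity in `c` keeps the first bound. -/
theorem exists_small_weak_tail_modulusSeminorm (hX : Measurable X)
    (hconv : ∀ F : C(T, ℝ) →ᵇ ℝ, Tendsto
      (fun n : ℕ => ∫ ω : ℕ → Ω, F ((√(n : ℝ))⁻¹ • ∑ j ∈ Finset.range n, X (ω j))
        ∂(Measure.infinitePi fun _ : ℕ => P)) atTop (𝓝 (∫ f, F f ∂γ)))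
    {δ : ℝ} (hδ : 0 < δ) (N : ℕ) :
    ∃ c : ℕ, N ≤ c ∧
      ∀ t : ℝ, 0 < t → t ^ 2 * P.real {ω | t < modulusSeminorm T c (X ω)} ≤ δ := by
  set ε := √(δ / 18) with hε
  have hε0 : 0 < ε := Real.sqrt_pos.2 (by positivity)
  have hεδ : 18 * ε ^ 2 = δ := by rw [hε, Real.sq_sqrt (by positivity)]; ring
  have hlim : Tendsto (fun c : ℕ => ∫ f, min 1 (modulusSeminorm T c f / ε) ∂γ) atTop
      (𝓝 (∫ _, (0 : ℝ) ∂γ)) := by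
    refine tendsto_integral_of_dominated_convergence (fun _ => 1) (fun c => ?_)
      (integrable_const _) (fun c => ae_of_all _ fun f => ?_) (ae_of_all _ fun f => ?_)
    · have := continuous_modulusSeminorm (T := T) c
      exact (by fun_prop : Continuous fun f => min 1
        (modulusSeminorm T c f / ε)).aestronglyMeasurable
    · rw [Real.norm_of_nonneg (le_min zero_le_one (div_nonneg (apply_nonneg _ _) hε0.le))]
      exact min_le_left _ _
    · simpa using (tendsto_const_nhds (x := (1 : ℝ))).min ((tendsto_modulusSeminorm f).div_const ε)
  rw [integral_zero] at hlim
  obtain ⟨c₀, hc₀⟩ := (hlim.eventually_lt_const (by norm_num : (0 : ℝ) < 1 / 16)).exists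
  obtain ⟨t₀, ht₀, h⟩ := eventually_weak_tail_of_weak_convergence hX γ hconv
    (modulusSeminorm T c₀) (continuous_modulusSeminorm c₀) hε0 hc₀
  have hsmall : Tendsto (fun c : ℕ => t₀ ^ 2 * P.real {ω | ε < modulusSeminorm T c (X ω)}) atTop
      (𝓝 (t₀ ^ 2 * 0)) := by
    refine (tendsto_measureReal_of_antitone (fun c =>
      measurableSet_lt measurable_const (measurable_modulusSeminorm_comp hX c)) ?_ ?_).const_mul _
    · intro c c' hcc ω hω
      exact lt_of_lt_of_le hω (antitone_modulusSeminorm (X ω) hcc)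
    · refine Set.eq_empty_of_forall_notMem fun ω hω => ?_
      obtain ⟨c, hc⟩ := ((tendsto_modulusSeminorm (X ω)).eventually_lt_const hε0).exists
      exact absurd (Set.mem_iInter.1 hω c) (by simpa using hc.le)
  rw [mul_zero] at hsmall
  obtain ⟨c, hc, hcN, hcc₀⟩ := ((hsmall.eventually_lt_const hδ).and
    ((eventually_ge_atTop N).and (eventually_ge_atTop c₀))).exists
  refine ⟨c, hcN, fun t ht => ?_⟩
  rcases le_or_gt t₀ t with h' | h'
  · refine le_trans ?_ ((h t h').trans hεδ.le)
    refine mul_le_mul_of_nonneg_left (measureReal_mono fun ω hω => ?_) (by positivity)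
    exact lt_of_lt_of_le hω (antitone_modulusSeminorm (X ω) hcc₀)
  rcases le_or_gt t ε with h'' | h''
  · calc t ^ 2 * P.real {ω | t < modulusSeminorm T c (X ω)} ≤ ε ^ 2 * 1 := by
          gcongr; exact measureReal_le_one
      _ ≤ δ := by nlinarith [sq_nonneg ε]
  · refine le_trans ?_ hc.le
    refine mul_le_mul (by gcongr) (measureReal_mono fun ω hω => ?_) measureReal_nonneg
      (by positivity)
    exact lt_trans h'' hω

end WeakModulus

end ContinuousCLT

theorem proposition3p2 {T : Type*} [MetricSpace T] [CompactSpace T]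
    {Ω : Type*} [MeasurableSpace Ω] (P : Measure Ω) [IsProbabilityMeasure P]
    (η : T → Ω → ℝ)
    (hL2 : ∀ t : T, MemLp (η t) 2 P)
    (hcentered : ∀ t : T, ∫ ω, η t ω ∂P = 0)
    (hcont : ContinuousCLT.SampleContinuous η P)
    (hCLT : ContinuousCLT.SatisfiesCLT η P) :
    ∃ (ρ : T → T → ℝ) (M : Ω → ℝ),
      ContinuousCLT.IsContinuousSemidistance ρ ∧
      Measurable M ∧
      ContinuousCLT.Factorization η P M ρ ∧
      ∀ p : ℝ, 0 < p → p < 2 → Integrable (fun ω => |M ω| ^ p) P := by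
  open ContinuousCLT in
  obtain ⟨-, γ, hγ, -, hlim⟩ := hCLT
  obtain ⟨X, hX, hXη⟩ := exists_measurable_path (fun t => (hL2 t).1.aemeasurable) hcont
  have hconv : ∀ F : C(T, ℝ) →ᵇ ℝ, Tendsto
      (fun n : ℕ => ∫ ω : ℕ → Ω, F ((√(n : ℝ))⁻¹ • ∑ j ∈ Finset.range n, X (ω j))
        ∂(Measure.infinitePi fun _ : ℕ => P)) atTop (𝓝 (∫ f, F f ∂γ)) := by
    intro F
    refine (hlim F).congr fun n => integral_congr_ae ?_
    filter_upwards [samplePath_normalizedSum_ae_eq hXη n] with ω hω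
    rw [hω]
  obtain ⟨K, hK⟩ := exists_weak_tail_modulusSeminorm hX hconv 0
  have hsmall := fun k : ℕ => exists_small_weak_tail_modulusSeminorm hX hconv
    (by positivity : (0 : ℝ) < (1 / 16) ^ k) k
  choose c' hc'k hc' using hsmall
  -- Scale `0` is overridden so that the coarsest seminorm sees all pairs; its tail constant `K`
  -- need not be at most `1`, hence `max K 1` below.
  set c : ℕ → ℕ := fun k => if k = 0 then 0 else c' k with hcdef
  have hc0 : c 0 = 0 := by simp [hcdef]
  have hck : ∀ k, k ≤ c k := by
    intro k
    by_cases h : k = 0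
    · simp [h]
    · simpa [hcdef, h] using hc'k k
  obtain ⟨M, hMm, hM0, hM, hMt⟩ := exists_envelope_of_weak_tails (P := P)
    (g := fun k ω => modulusSeminorm T (c k) (X ω)) (K := max K 1)
    (fun k => measurable_modulusSeminorm_comp hX (c k)) (by
      intro k t ht
      by_cases h : k = 0
      · subst h
        simpa [hc0] using Or.inl (hK t ht)
      · have := hc' k t ht
        simp only [hcdef, h, if_false]
        refine this.trans (le_mul_of_one_le_left (by positivity) (le_max_right _ _)))
  refine ⟨scaleSemidistance c, M, isContinuousSemidistance_scaleSemidistance c, hMm, ?_,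
    fun p hp hp2 => integrable_rpow_of_weak_tail hMm hM0 hMt hp hp2⟩
  filter_upwards [hXη, hM] with ω h1 h2 t s
  rw [← h1, ← h1]
  exact abs_sub_le_mul_scaleSemidistance hc0 hck (hM0 ω) h2 t s
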